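/- Let $\omega(s)=s(1-\log s)\log(1-\log s)$ for $0<s\le e^{1-e}$ (the LogLog-Lipschitz modulus). Let $n\in\mathbb{N}$, $0<T'<T$ and $k_A,k_B,k_C>0$. Consider operators on $[0,T]\times\mathbb{R}^n$ with coefficients depending only on time, $$\mathcal{L}u=\partial_t u+\sum_{i,j=1}^n\partial_{x_i}\big(a_{i,j}(t)\partial_{x_j}u\big)+\sum_{j=1}^n b_j(t)\,\partial_{x_j}u+c(t)\,u ,$$ where, for all $t\in[0,T]$, the matrix $(a_{i,j}(t))$ is real and symmetric with $k_A|\xi|^2\le\sum_{i,j}a_{i,j}(t)\xi_i\xi_j\le k_A^{-1}|\xi|^2$ for all $\xi\in\mathbb{R}^n$; $b_j$ and $c$ are measurable and complex-valued with $|b_j(t)|\le k_B$, $|c(t)|\le k_C$; and every $a_{i,j}$ belongs to $C^\omega([0,T])$, i.e. there is $K$ with $|a_{i,j}(t)-a_{i,j}(s)|\le K\,\omega(|t-s|)$ for all $t,s\in[0,T]$ with $0<|t-s|\le e^{1-e}$. Let $\mathcal{H}_0=C([0,T],L^2(\mathbb{R}^n))\cap C([0,T[,H^1(\mathbb{R}^n))\cap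 C^1([0,T[,L^2(\mathbb{R}^n))$ (complex-valued functions). Then there are constants $\tilde\sigma>0$, $\tilde\tau>0$ and $\tilde\delta\in\,]0,1[$, depending only on $n,k_A,k_B,k_C,\omega,T,T'$, such that for every $D>0$ there are a $\rho>0$ with $\rho^2\le e^{-2\tilde\tau}$ and a continuous, strictly increasing function $G:[0,+\infty[\to[0,+\infty[$ with $G(0)=0$, both depending in addition only on $D$, such that $$G(y)=\exp\Big\{-\tilde\sigma\exp\Big[\Big(\log\Big(\tfrac{1}{2\tilde\tau}|\log y|\Big)\Big)^{\tilde\delta}\Big]\Big\}\qquad\text{for } 0<y\le\rho^2,$$ and such that, for every operator $\mathcal{L}$ as above and every solution $u\in\mathcal{H}_0$ of $\mathcal{L}u=0$ on $]0,T[\times\mathbb{R}^n$ (that is, for almost every $t$, in the sense of distributions in $x$) with $\|u(t,\cdot)\|_{L^2}\le D$ for all $t\in[0,T]$ and $\|u(0,\cdot)\|_{L^2}\le\rho$, $$\sup_{t\in[0,T']}\|u(t,\cdot)\|_{L^2}^2\le G\big(\|u(0,\cdot)\|_{L^2}^2\big).$$ In particular, if $u(0,\cdot)\neq0$, then $$\sup_{t\in[0,T']}\|u(t,\cdot)\|^2_{L^2}\le\exp\Big\{-\tilde\sigma\exp\Big[\Big(\log\Big(\tfrac1{2\tilde\tau}\big|\log\|u(0,\cdot)\|^2_{L^2}\big|\Big)\Big)^{\tilde\delta}\Big]\Big\},$$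 and if $u(0,\cdot)=0$, then $u=0$ on $[0,T']$. -/

import Mathlib

open MeasureTheory Set
open scoped SchwartzMap LineDeriv

noncomputable section

namespace BackwardParabolic

/-- The complex Hilbert space `L²(ℝⁿ)`. -/
abbrev L2 (n : ℕ) : Type := Lp ℂ 2 (volume : Measure (EuclideanSpace ℝ (Fin n)))

/-- The tempered distribution on `ℝⁿ` given by an `L²` function. -/
def toDist {n : ℕ} (f : L2 n) : 𝓢'(EuclideanSpace ℝ (Fin n), ℂ) :=
  Lp.toTemperedDistribution f

/-- The distributional partial derivative `∂_{x_i}` on `ℝⁿ`. -/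
def pderiv {n : ℕ} (i : Fin n) (f : 𝓢'(EuclideanSpace ℝ (Fin n), ℂ)) :
    𝓢'(EuclideanSpace ℝ (Fin n), ℂ) :=
  ∂_{(EuclideanSpace.single i (1 : ℝ) : EuclideanSpace ℝ (Fin n))} f

/-- The LogLog-Lipschitz modulus `ω(s) = s (1 - log s) log (1 - log s)`, used for
`0 < s ≤ e^{1-e}`. -/
def logLogModulus (s : ℝ) : ℝ :=
  s * (1 - Real.log s) * Real.log (1 - Real.log s)

/-- `f ∈ C^ω([0,T])` for the LogLog-Lipschitz modulus `ω`. -/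
def IsLogLogLipschitz (T : ℝ) (f : ℝ → ℝ) : Prop :=
  ∃ K : ℝ, ∀ t ∈ Icc 0 T, ∀ s ∈ Icc 0 T, 0 < |t - s| → |t - s| ≤ Real.exp (1 - Real.exp 1) →
    |f t - f s| ≤ K * logLogModulus |t - s|

/-- The coefficients, depending on time only, of the operator
`ℒ u = ∂ₜ u + ∑ᵢⱼ ∂ᵢ (aᵢⱼ(t) ∂ⱼ u) + ∑ⱼ bⱼ(t) ∂ⱼ u + c(t) u`. -/
structure Coefficients (n : ℕ) where
  /-- the (real) coefficients of the principal part -/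
  a : ℝ → Fin n → Fin n → ℝ
  /-- the (complex) coefficients of order one -/
  b : ℝ → Fin n → ℂ
  /-- the (complex) coefficient of order zero -/
  c : ℝ → ℂ

/-- The standing assumptions on the operator on `[0,T]`: symmetry, ellipticity with constant `kA`,
bounds `kB`, `kC` on the (measurable) lower order coefficients, and LogLog-Lipschitz regularity in
time of the principal part. -/
structure Coefficients.Admissible {n : ℕ} (L : Coefficients n) (T kA kB kC : ℝ) : Prop where
  symm : ∀ t ∈ Icc 0 T, ∀ i j, L.a t i j = L.a t j i
  elliptic_lower : ∀ t ∈ Icc 0 T, ∀ ξ : EuclideanSpace ℝ (Fin n),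
    kA * ‖ξ‖ ^ 2 ≤ ∑ i, ∑ j, L.a t i j * ξ i * ξ j
  elliptic_upper : ∀ t ∈ Icc 0 T, ∀ ξ : EuclideanSpace ℝ (Fin n),
    ∑ i, ∑ j, L.a t i j * ξ i * ξ j ≤ kA⁻¹ * ‖ξ‖ ^ 2
  b_measurable : ∀ j, AEStronglyMeasurable (fun t => L.b t j) (volume.restrict (Icc 0 T))
  b_bound : ∀ t ∈ Icc 0 T, ∀ j, ‖L.b t j‖ ≤ kB
  c_measurable : AEStronglyMeasurable L.c (volume.restrict (Icc 0 T))
  c_bound : ∀ t ∈ Icc 0 T, ‖L.c t‖ ≤ kC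
  regular : ∀ i j, IsLogLogLipschitz T (fun t => L.a t i j)

/-- `u ∈ C([0,T[, H¹)`: `u` is continuous into `L²` and, for each `j`, the distributional
derivative `∂ⱼ u(t)` is an `L²` function depending continuously on `t` in `L²`. -/
def ContinuousIntoH1 {n : ℕ} (T : ℝ) (u : ℝ → L2 n) : Prop :=
  ContinuousOn u (Ico 0 T) ∧
    ∀ j : Fin n, ∃ v : ℝ → L2 n, ContinuousOn v (Ico 0 T) ∧
      ∀ t ∈ Ico 0 T, pderiv j (toDist (u t)) = toDist (v t)

/-- The space `ℋ₀ = C([0,T], L²) ∩ C([0,T[, H¹) ∩ C¹([0,T[, L²)`. -/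
structure MemH0 {n : ℕ} (T : ℝ) (u : ℝ → L2 n) : Prop where
  continuousOn : ContinuousOn u (Icc 0 T)
  continuousIntoH1 : ContinuousIntoH1 T u
  contDiffOn : ContDiffOn ℝ 1 u (Ico 0 T)

/-- `u` solves `ℒ u = 0` on the strip `]0,T[ × ℝⁿ`: for almost every time the equation holds in
the sense of distributions in `x`. Here `∂ₜ u` is the derivative of `u` as an `L²`-valued map. -/
def Coefficients.IsSolution {n : ℕ} (L : Coefficients n) (T : ℝ) (u : ℝ → L2 n) : Prop :=
  ∀ᵐ t ∂(volume.restrict (Ioo 0 T)),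
    toDist (deriv u t)
      + ∑ i, ∑ j, pderiv i ((L.a t i j : ℂ) • pderiv j (toDist (u t)))
      + ∑ j, L.b t j • pderiv j (toDist (u t))
      + L.c t • toDist (u t) = 0

/-- The explicit function `y ↦ exp {-σ exp [(log ((1 / (2τ)) |log y|))^δ]}`. -/
def doubleExpBound (σ τ δ y : ℝ) : ℝ :=
  Real.exp (-(σ * Real.exp ((Real.log (1 / (2 * τ) * |Real.log y|)) ^ δ)))

end BackwardParabolic

end

/-!
Since the coefficients depend on time only, the Fourier transform in `x` turns `ℒ u = 0` into the
family of ordinary differential equations `∂ₜ û(t, ξ) = m(t, ξ) û(t, ξ)`, where the symbol `m` is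
`4π² ∑ aᵢⱼ ξᵢ ξⱼ` up to terms of order one (`Coefficients.fourier_ae_eq_symbol_mul`). Ellipticity
gives `Re m ≤ M R²` on `{|ξ| ≤ R}` and `Re m ≥ κ R²` on `{|ξ| > R}` once `R` is large, with `M` and
`κ` depending only on `n`, `kA`, `kB`, `kC`. Grönwall's inequality, run forward from time `0` on the
low frequencies and backward from time `T` on the high ones, yields
`‖u t‖² ≤ e^{2MR²t} ‖u 0‖² + e^{-2κR²(T - t)} D²` (`Coefficients.IsSolution.norm_sq_le`). The choice
`R² = log (1/y) / (4MT)` for `y ≥ ‖u 0‖²` then gives, uniformly for `t ≤ T' < T`, the Hölder bound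
`‖u t‖² ≤ (1 + D²) y^η` with `η > 0` (`exists_holder_stability`).

With `σ = τ = 1`, `δ = 1/2` and `Λ = -log y`, the function in the claim is
`exp (-exp √(log (Λ/2)))`. As `exp √(log (Λ/2))` is `o(Λ)`, this dominates `(1 + D²) y^η` as soon as
`y` is below a threshold depending on `D`, and that threshold determines `ρ`.
-/

namespace BackwardParabolic

open scoped FourierTransform ContDiff

/-! ### The equation on the Fourier side -/

/-- The Fourier symbol `m(t, ξ)` for which `ℒ u = 0` reads `∂ₜ û(t, ξ) = m(t, ξ) û(t, ξ)`; the
Fourier transform is normalised with the character `e^{-2πi⟨x, ξ⟩}`. -/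
noncomputable def Coefficients.symbol {n : ℕ} (L : Coefficients n) (t : ℝ)
    (ξ : EuclideanSpace ℝ (Fin n)) : ℂ :=
  4 * Real.pi ^ 2 * ∑ i, ∑ j, (L.a t i j : ℂ) * (ξ i : ℂ) * (ξ j : ℂ)
    - 2 * Real.pi * Complex.I * ∑ j, L.b t j * (ξ j : ℂ) - L.c t

theorem hasTemperateGrowth_coord {n : ℕ} (i : Fin n) :
    (fun ξ : EuclideanSpace ℝ (Fin n) => (ξ i : ℂ)).HasTemperateGrowth := by
  have h : (fun ξ : EuclideanSpace ℝ (Fin n) => (ξ i : ℂ)) =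
      (Complex.ofRealCLM ∘L (EuclideanSpace.proj i : EuclideanSpace ℝ (Fin n) →L[ℝ] ℝ)) := by
    ext; simp
  rw [h]
  exact ContinuousLinearMap.hasTemperateGrowth _

/-- The Fourier transform turns `∂ᵢ` into multiplication by `2πi ξᵢ`. -/
theorem fourier_pderiv {n : ℕ} (i : Fin n) (f : 𝓢'(EuclideanSpace ℝ (Fin n), ℂ)) :
    𝓕 (pderiv i f) = (2 * Real.pi * Complex.I) •
      TemperedDistribution.smulLeftCLM ℂ (fun ξ : EuclideanSpace ℝ (Fin n) => (ξ i : ℂ)) (𝓕 f) := by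
  rw [pderiv, TemperedDistribution.fourier_lineDerivOp_eq]
  congr 4
  ext ξ
  simp [EuclideanSpace.inner_single_right]

/-- Integration against the symbol, expanded into the moments produced by the individual terms of
the operator. -/
theorem Coefficients.integral_mul_symbol {n : ℕ} (L : Coefficients n) (t : ℝ) (F : L2 n)
    (φ : 𝓢(EuclideanSpace ℝ (Fin n), ℂ)) :
    ∫ ξ, φ ξ * (L.symbol t ξ * F ξ) =
      -(∑ i, ∑ j, 2 * Real.pi * Complex.I * ((L.a t i j : ℂ) * (2 * Real.pi * Complex.I *
        ∫ ξ, (ξ i : ℂ) * (ξ j : ℂ) * φ ξ * F ξ)))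
      - ∑ j, L.b t j * (2 * Real.pi * Complex.I * ∫ ξ, (ξ j : ℂ) * φ ξ * F ξ)
      - L.c t * ∫ ξ, φ ξ * F ξ := by
  have hI : ∀ ψ : 𝓢(EuclideanSpace ℝ (Fin n), ℂ), Integrable (fun ξ => ψ ξ * F ξ) := fun ψ =>
    (ψ.memLp 2).integrable_mul (Lp.memLp F)
  have hI₁ : ∀ j, Integrable (fun ξ : EuclideanSpace ℝ (Fin n) => (ξ j : ℂ) * φ ξ * F ξ) := by
    intro j
    simpa [SchwartzMap.smulLeftCLM_apply_apply (hasTemperateGrowth_coord j)] using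
      hI (SchwartzMap.smulLeftCLM ℂ (fun ξ : EuclideanSpace ℝ (Fin n) => (ξ j : ℂ)) φ)
  have hI₂ : ∀ i j, Integrable
      (fun ξ : EuclideanSpace ℝ (Fin n) => (ξ i : ℂ) * (ξ j : ℂ) * φ ξ * F ξ) := by
    intro i j
    simpa [SchwartzMap.smulLeftCLM_apply_apply
      ((hasTemperateGrowth_coord i).mul (hasTemperateGrowth_coord j))] using
      hI (SchwartzMap.smulLeftCLM ℂ ((fun ξ : EuclideanSpace ℝ (Fin n) => (ξ i : ℂ)) *
        (fun ξ : EuclideanSpace ℝ (Fin n) => (ξ j : ℂ))) φ)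
  have hI₂' : ∀ i j, Integrable (fun ξ : EuclideanSpace ℝ (Fin n) =>
      2 * Real.pi * Complex.I * ((L.a t i j : ℂ) * (2 * Real.pi * Complex.I *
        ((ξ i : ℂ) * (ξ j : ℂ) * φ ξ * F ξ)))) := fun i j =>
    (((hI₂ i j).const_mul _).const_mul _).const_mul _
  have hI₁' : ∀ j, Integrable (fun ξ : EuclideanSpace ℝ (Fin n) =>
      L.b t j * (2 * Real.pi * Complex.I * ((ξ j : ℂ) * φ ξ * F ξ))) := fun j =>
    ((hI₁ j).const_mul _).const_mul _
  have hS₂ : Integrable (fun ξ : EuclideanSpace ℝ (Fin n) => ∑ i, ∑ j,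
      2 * Real.pi * Complex.I * ((L.a t i j : ℂ) * (2 * Real.pi * Complex.I *
        ((ξ i : ℂ) * (ξ j : ℂ) * φ ξ * F ξ)))) :=
    integrable_finsetSum _ fun i _ => integrable_finsetSum _ fun j _ => hI₂' i j
  have hS₁ : Integrable (fun ξ : EuclideanSpace ℝ (Fin n) => ∑ j,
      L.b t j * (2 * Real.pi * Complex.I * ((ξ j : ℂ) * φ ξ * F ξ))) :=
    integrable_finsetSum _ fun j _ => hI₁' j
  have hR : ∀ ξ, φ ξ * (L.symbol t ξ * F ξ) =
      -(∑ i, ∑ j, 2 * Real.pi * Complex.I * ((L.a t i j : ℂ) * (2 * Real.pi * Complex.I *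
        ((ξ i : ℂ) * (ξ j : ℂ) * φ ξ * F ξ))))
      - ∑ j, L.b t j * (2 * Real.pi * Complex.I * ((ξ j : ℂ) * φ ξ * F ξ))
      - L.c t * (φ ξ * F ξ) := by
    intro ξ
    simp only [Coefficients.symbol, mul_sub, sub_mul, Finset.mul_sum, Finset.sum_mul,
      ← Finset.sum_neg_distrib]
    congr 1
    congr 1
    · refine Finset.sum_congr rfl fun i _ => Finset.sum_congr rfl fun j _ => ?_
      linear_combination (4 * (Real.pi : ℂ) ^ 2 * L.a t i j * ξ i * ξ j * φ ξ * F ξ) *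
        Complex.I_sq
    · refine Finset.sum_congr rfl fun i _ => ?_
      ring
    · ring
  simp only [hR]
  rw [integral_sub, integral_sub, integral_neg,
    integral_finsetSum _ fun i _ => integrable_finsetSum _ fun j _ => hI₂' i j,
    integral_finsetSum _ fun j _ => hI₁' j,
    Finset.sum_congr rfl fun i _ => integral_finsetSum _ fun j _ => hI₂' i j]
  · simp only [integral_const_mul]
  · exact hS₂.neg
  · exact hS₁
  · exact hS₂.neg.sub hS₁
  · exact (hI φ).const_mul _

/-- The equation on the Fourier side, tested against Schwartz functions. -/
theorem Coefficients.integral_fourier_eq {n : ℕ} (L : Coefficients n) (t : ℝ) (f g : L2 n)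
    (h : toDist g + ∑ i, ∑ j, pderiv i ((L.a t i j : ℂ) • pderiv j (toDist f))
      + ∑ j, L.b t j • pderiv j (toDist f) + L.c t • toDist f = 0)
    (φ : 𝓢(EuclideanSpace ℝ (Fin n), ℂ)) :
    ∫ ξ, φ ξ * (𝓕 g : L2 n) ξ = ∫ ξ, φ ξ * (L.symbol t ξ * (𝓕 f : L2 n) ξ) := by
  rw [L.integral_mul_symbol]
  have hF := congrArg (fun S : 𝓢'(EuclideanSpace ℝ (Fin n), ℂ) =>
    (FourierTransform.fourierCLM ℂ 𝓢'(EuclideanSpace ℝ (Fin n), ℂ) S) φ) h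
  have hd (f : L2 n) : 𝓕 (toDist f) = toDist (𝓕 f) := Lp.fourier_toTemperedDistribution_eq f
  simp only [map_add, map_sum, map_smul, FourierTransform.fourierCLM_apply, fourier_pderiv, hd,
    FourierTransform.fourier_smul, map_zero] at hF
  generalize (𝓕 f : L2 n) = F at hF ⊢
  generalize (𝓕 g : L2 n) = G at hF ⊢
  simp only [toDist] at hF
  simp [hasTemperateGrowth_coord] at hF
  have hm : ∀ i j, SchwartzMap.smulLeftCLM ℂ ((fun ξ : EuclideanSpace ℝ (Fin n) => (ξ j : ℂ)) *
      (fun ξ : EuclideanSpace ℝ (Fin n) => (ξ i : ℂ))) φ =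
      fun ξ => (ξ i : ℂ) * (ξ j : ℂ) * φ ξ := by
    intro i j
    rw [SchwartzMap.smulLeftCLM_apply
      ((hasTemperateGrowth_coord j).mul (hasTemperateGrowth_coord i))]
    ext ξ
    simp [mul_comm]
  simp only [hm] at hF
  linear_combination hF

theorem Coefficients.continuous_symbol {n : ℕ} (L : Coefficients n) (t : ℝ) :
    Continuous (L.symbol t) := by
  unfold Coefficients.symbol
  fun_prop

/-- On the Fourier side, a solution satisfies the ordinary differential equation
`∂ₜ û = m(t, ξ) û` for almost every `ξ`. -/
theorem Coefficients.fourier_ae_eq_symbol_mul {n : ℕ} (L : Coefficients n) (t : ℝ) (f g : L2 n)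
    (h : toDist g + ∑ i, ∑ j, pderiv i ((L.a t i j : ℂ) • pderiv j (toDist f))
      + ∑ j, L.b t j • pderiv j (toDist f) + L.c t • toDist f = 0) :
    ∀ᵐ ξ, (𝓕 g : L2 n) ξ = L.symbol t ξ * (𝓕 f : L2 n) ξ := by
  have hlocg : LocallyIntegrable (𝓕 g : L2 n) volume :=
    (Lp.memLp _).locallyIntegrable one_le_two
  have hlocf : LocallyIntegrable (fun ξ => L.symbol t ξ * (𝓕 f : L2 n) ξ) volume := by
    rw [← locallyIntegrableOn_univ]
    exact (locallyIntegrableOn_univ.2 ((Lp.memLp (𝓕 f : L2 n)).locallyIntegrable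
      one_le_two)).continuousOn_mul (L.continuous_symbol t).continuousOn isClosed_univ.isLocallyClosed
  have key : ∀ᵐ ξ, (𝓕 g : L2 n) ξ - L.symbol t ξ * (𝓕 f : L2 n) ξ = 0 := by
    refine ae_eq_zero_of_integral_contDiff_smul_eq_zero (hlocg.sub hlocf) fun φ hφ hφc => ?_
    have h₁ : HasCompactSupport (Complex.ofRealCLM ∘ φ) := hφc.comp_left rfl
    have h₂ : ContDiff ℝ ∞ (Complex.ofRealCLM ∘ φ) := by fun_prop
    have h₃ := L.integral_fourier_eq t f g h (h₁.toSchwartzMap h₂)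
    simp at h₃
    have e : ∀ ξ, φ ξ • ((𝓕 g : L2 n) ξ - L.symbol t ξ * (𝓕 f : L2 n) ξ) =
      φ ξ • (𝓕 g : L2 n) ξ - φ ξ • (L.symbol t ξ * (𝓕 f : L2 n) ξ) := fun ξ => smul_sub _ _ _
    simp only [e]
    rw [integral_sub]
    · simp only [Complex.real_smul]
      rw [h₃, sub_self]
    · exact hlocg.integrable_smul_left_of_hasCompactSupport hφ.continuous hφc
    · exact hlocf.integrable_smul_left_of_hasCompactSupport hφ.continuous hφc
  filter_upwards [key] with ξ hξ using sub_eq_zero.1 hξ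

/-! ### Bounds on the symbol -/

theorem norm_sum_mul_coord_le {n : ℕ} {kB : ℝ} (b : Fin n → ℂ) (hb : ∀ j, ‖b j‖ ≤ kB)
    (ξ : EuclideanSpace ℝ (Fin n)) : ‖∑ j, b j * (ξ j : ℂ)‖ ≤ n * kB * ‖ξ‖ := by
  have h : ∀ j ∈ Finset.univ, ‖b j * (ξ j : ℂ)‖ ≤ kB * ‖ξ‖ := fun j _ => by
    rw [norm_mul, Complex.norm_real]
    exact mul_le_mul (hb j) (PiLp.norm_apply_le ξ j) (norm_nonneg _)
      ((norm_nonneg _).trans (hb j))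
  refine (norm_sum_le_of_le _ h).trans_eq ?_
  simp [mul_assoc]

/-- The symbol is a perturbation of order one of its principal part. -/
theorem Coefficients.Admissible.abs_re_symbol_sub_le {n : ℕ} {L : Coefficients n}
    {T kA kB kC : ℝ} (hL : L.Admissible T kA kB kC) {t : ℝ} (ht : t ∈ Icc 0 T)
    (ξ : EuclideanSpace ℝ (Fin n)) :
    |(L.symbol t ξ).re - 4 * Real.pi ^ 2 * ∑ i, ∑ j, L.a t i j * ξ i * ξ j| ≤
      2 * Real.pi * (n * kB) * ‖ξ‖ + kC := by
  have e : (L.symbol t ξ).re - 4 * Real.pi ^ 2 * ∑ i, ∑ j, L.a t i j * ξ i * ξ j =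
      (-(2 * Real.pi * Complex.I * ∑ j, L.b t j * (ξ j : ℂ)) - L.c t).re := by
    have : L.symbol t ξ = ((4 * Real.pi ^ 2 * ∑ i, ∑ j, L.a t i j * ξ i * ξ j : ℝ) : ℂ) +
        (-(2 * Real.pi * Complex.I * ∑ j, L.b t j * (ξ j : ℂ)) - L.c t) := by
      rw [Coefficients.symbol]
      push_cast
      ring
    rw [this, Complex.add_re, Complex.ofReal_re]
    ring
  rw [e]
  refine (Complex.abs_re_le_norm _).trans ((norm_sub_le _ _).trans ?_)
  refine add_le_add ?_ (hL.c_bound t ht)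
  rw [norm_neg, norm_mul]
  have h2 : ‖(2 * Real.pi * Complex.I : ℂ)‖ = 2 * Real.pi := by
    simp [abs_of_pos Real.pi_pos]
  rw [h2, mul_assoc (2 * Real.pi)]
  exact mul_le_mul_of_nonneg_left (norm_sum_mul_coord_le _ (hL.b_bound t ht) ξ)
    (by positivity)

theorem Coefficients.Admissible.re_symbol_le {n : ℕ} {L : Coefficients n}
    {T kA kB kC : ℝ} (hL : L.Admissible T kA kB kC) (hkA : 0 < kA) (hkB : 0 < kB) (hkC : 0 < kC)
    {t : ℝ} (ht : t ∈ Icc 0 T) {R : ℝ} (hR : 1 ≤ R)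
    {ξ : EuclideanSpace ℝ (Fin n)} (hξ : ‖ξ‖ ≤ R) :
    (L.symbol t ξ).re ≤ (4 * Real.pi ^ 2 * kA⁻¹ + 2 * Real.pi * (n * kB) + kC) * R ^ 2 := by
  have h1 := (abs_le.1 (hL.abs_re_symbol_sub_le ht ξ)).2
  have h2 := mul_le_mul_of_nonneg_left (hL.elliptic_upper t ht ξ)
    (by positivity : 0 ≤ 4 * Real.pi ^ 2)
  have h3 : ‖ξ‖ ^ 2 ≤ R ^ 2 := by gcongr
  have h4 : ‖ξ‖ ≤ R ^ 2 := hξ.trans (by nlinarith)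
  have h5 : 1 ≤ R ^ 2 := by nlinarith
  have h6 := mul_le_mul_of_nonneg_left h3 (by positivity : 0 ≤ 4 * Real.pi ^ 2 * kA⁻¹)
  have h7 := mul_le_mul_of_nonneg_left h4 (by positivity : 0 ≤ 2 * Real.pi * (n * kB))
  have h8 := mul_le_mul_of_nonneg_left h5 hkC.le
  linarith

theorem Coefficients.Admissible.le_re_symbol {n : ℕ} {L : Coefficients n}
    {T kA kB kC : ℝ} (hL : L.Admissible T kA kB kC) (hkA : 0 < kA) (hkC : 0 < kC)
    {t : ℝ} (ht : t ∈ Icc 0 T) {R : ℝ} (hR : 1 ≤ R)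
    (hR' : 2 * Real.pi * (n * kB) + kC ≤ 2 * Real.pi ^ 2 * kA * R)
    {ξ : EuclideanSpace ℝ (Fin n)} (hξ : R ≤ ‖ξ‖) :
    2 * Real.pi ^ 2 * kA * R ^ 2 ≤ (L.symbol t ξ).re := by
  have h1 := (abs_le.1 (hL.abs_re_symbol_sub_le ht ξ)).1
  have h2 := mul_le_mul_of_nonneg_left (hL.elliptic_lower t ht ξ)
    (by positivity : 0 ≤ 4 * Real.pi ^ 2)
  have h3 : R ^ 2 ≤ ‖ξ‖ ^ 2 := by gcongr
  have h4 : 2 * Real.pi * (n * kB) * ‖ξ‖ + kC ≤ 2 * Real.pi ^ 2 * kA * ‖ξ‖ ^ 2 :=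
    calc 2 * Real.pi * (n * kB) * ‖ξ‖ + kC
        ≤ (2 * Real.pi * (n * kB) + kC) * ‖ξ‖ := by nlinarith
      _ ≤ 2 * Real.pi ^ 2 * kA * R * ‖ξ‖ := by gcongr
      _ ≤ 2 * Real.pi ^ 2 * kA * ‖ξ‖ * ‖ξ‖ := by gcongr
      _ = 2 * Real.pi ^ 2 * kA * ‖ξ‖ ^ 2 := by ring
  have h6 := mul_le_mul_of_nonneg_left h3 (by positivity : 0 ≤ 2 * Real.pi ^ 2 * kA)
  linarith

/-! ### A Grönwall inequality -/

/-- A Grönwall inequality for a `C¹` function, where the differential inequality is only known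
almost everywhere: by continuity of the derivative it then holds everywhere. -/
theorem le_exp_mul_of_ae_deriv_le {T K : ℝ} {E E' : ℝ → ℝ} (hE : ContinuousOn E (Icc 0 T))
    (hd : ∀ t ∈ Ioo 0 T, HasDerivAt E (E' t) t) (hE' : ContinuousOn E' (Ioo 0 T))
    (h : ∀ᵐ t ∂(volume.restrict (Ioo 0 T)), E' t ≤ K * E t) {s t : ℝ} (hs : 0 ≤ s) (hst : s ≤ t)
    (ht : t ≤ T) : E t ≤ Real.exp (K * (t - s)) * E s := by
  have hall : ∀ t ∈ Ioo 0 T, E' t ≤ K * E t := by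
    have hc : ContinuousOn (fun t => E' t - K * E t) (Ioo 0 T) :=
      hE'.sub (continuousOn_const.mul (hE.mono Ioo_subset_Icc_self))
    have ho := hc.isOpen_inter_preimage isOpen_Ioo isOpen_Ioi (t := Ioi 0)
    have hz : volume (Ioo 0 T ∩ (fun t => E' t - K * E t) ⁻¹' Ioi 0) = 0 := by
      rw [ae_restrict_iff' measurableSet_Ioo, ae_iff] at h
      refine measure_mono_null ?_ h
      rintro t ⟨ht, ht'⟩
      simp only [mem_preimage, mem_Ioi, sub_pos] at ht'
      simp only [mem_ofPred_eq, Classical.not_imp, not_le]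
      exact ⟨ht, ht'⟩
    have he := ho.eq_empty_of_measure_zero hz
    intro t ht
    by_contra! hlt
    have : t ∈ Ioo 0 T ∩ (fun t => E' t - K * E t) ⁻¹' Ioi 0 := ⟨ht, by simpa using hlt⟩
    simp [he] at this
  have hg : ∀ t ∈ Ioo 0 T, HasDerivAt (fun t => Real.exp (-(K * t)) * E t)
      (Real.exp (-(K * t)) * (E' t - K * E t)) t := fun t ht => by
    have h1 : HasDerivAt (fun t => Real.exp (-(K * t))) (Real.exp (-(K * t)) * -K) t := by
      simpa using ((hasDerivAt_id t).const_mul K).neg.exp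
    convert! h1.mul (hd t ht) using 1
    ring
  have hanti : AntitoneOn (fun t => Real.exp (-(K * t)) * E t) (Icc 0 T) := by
    refine antitoneOn_of_deriv_nonpos (convex_Icc 0 T) (ContinuousOn.mul (by fun_prop) hE) ?_ ?_
    · rw [interior_Icc]
      exact fun t ht => (hg t ht).differentiableAt.differentiableWithinAt
    · rw [interior_Icc]
      intro t ht
      rw [(hg t ht).deriv]
      exact mul_nonpos_of_nonneg_of_nonpos (Real.exp_pos _).le (sub_nonpos.2 (hall t ht))
  have h2 := hanti ⟨hs, hst.trans ht⟩ ⟨hs.trans hst, ht⟩ hst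
  calc E t = Real.exp (K * t) * (Real.exp (-(K * t)) * E t) := by
        rw [← mul_assoc, ← Real.exp_add]; simp
    _ ≤ Real.exp (K * t) * (Real.exp (-(K * s)) * E s) := by gcongr
    _ = Real.exp (K * (t - s)) * E s := by
        rw [← mul_assoc, ← Real.exp_add]; ring_nf

/-! ### Restriction of the frequencies -/

/-- The operator `f ↦ 1_S f̂` with values in `L²(S)`. -/
noncomputable def freqRestrict {n : ℕ} (S : Set (EuclideanSpace ℝ (Fin n))) :
    L2 n →L[ℂ] Lp ℂ 2 (volume.restrict S) :=
  LpToLpRestrictCLM (EuclideanSpace ℝ (Fin n)) ℂ ℂ volume 2 S ∘L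
    FourierTransform.fourierCLM ℂ (L2 n)

theorem freqRestrict_ae_eq {n : ℕ} (S : Set (EuclideanSpace ℝ (Fin n))) (f : L2 n) :
    freqRestrict S f =ᵐ[volume.restrict S] (𝓕 f : L2 n) :=
  LpToLpRestrictCLM_coeFn ℂ S (𝓕 f : L2 n)

theorem norm_sq_eq_integral {α : Type*} [MeasurableSpace α] {μ : Measure α} (f : Lp ℂ 2 μ) :
    ‖f‖ ^ 2 = ∫ x, ‖f x‖ ^ 2 ∂μ := by
  rw [← inner_self_eq_norm_sq (𝕜 := ℂ), L2.inner_def, ← integral_re (L2.integrable_inner f f)]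
  simp only [inner_self_eq_norm_sq]

/-- Plancherel's theorem, with the frequencies split into `S` and its complement. -/
theorem norm_sq_freqRestrict_add {n : ℕ} {S : Set (EuclideanSpace ℝ (Fin n))}
    (hS : MeasurableSet S) (f : L2 n) :
    ‖freqRestrict S f‖ ^ 2 + ‖freqRestrict Sᶜ f‖ ^ 2 = ‖f‖ ^ 2 := by
  have h : ∀ S, ‖freqRestrict S f‖ ^ 2 = ∫ ξ in S, ‖(𝓕 f : L2 n) ξ‖ ^ 2 := fun S => by
    rw [norm_sq_eq_integral]
    exact integral_congr_ae ((freqRestrict_ae_eq S f).fun_comp (fun z => ‖z‖ ^ 2))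
  rw [h, h, integral_add_compl hS, ← norm_sq_eq_integral, Lp.norm_fourier_eq]
  exact (Lp.memLp (𝓕 f : L2 n)).integrable_norm_pow two_ne_zero

theorem norm_sq_freqRestrict_le {n : ℕ} {S : Set (EuclideanSpace ℝ (Fin n))}
    (hS : MeasurableSet S) (f : L2 n) : ‖freqRestrict S f‖ ^ 2 ≤ ‖f‖ ^ 2 := by
  rw [← norm_sq_freqRestrict_add hS f]
  exact le_add_of_nonneg_right (sq_nonneg _)

theorem re_inner_nonneg_of_ae {α : Type*} [MeasurableSpace α] {μ : Measure α} {f g : Lp ℂ 2 μ}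
    (h : ∀ᵐ x ∂μ, 0 ≤ (inner ℂ (f x) (g x)).re) : 0 ≤ (inner ℂ f g).re := by
  have e : (inner ℂ f g).re = ∫ x, (inner ℂ (f x) (g x)).re ∂μ := by
    rw [L2.inner_def]
    exact (integral_re (L2.integrable_inner (𝕜 := ℂ) f g)).symm
  rw [e]
  exact integral_nonneg_of_ae h

/-- If `ĝ = m f̂`, a bound on `Re m` over the frequency set `S` bounds `Re ⟨1_S f̂, 1_S ĝ⟩`. -/
theorem re_inner_freqRestrict_le {n : ℕ} {S : Set (EuclideanSpace ℝ (Fin n))}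
    (hS : MeasurableSet S) {m : EuclideanSpace ℝ (Fin n) → ℂ} {f g : L2 n}
    (h : ∀ᵐ ξ, (𝓕 g : L2 n) ξ = m ξ * (𝓕 f : L2 n) ξ) {K : ℝ} (hK : ∀ ξ ∈ S, (m ξ).re ≤ K) :
    (inner ℂ (freqRestrict S f) (freqRestrict S g)).re ≤ K * ‖freqRestrict S f‖ ^ 2 := by
  have key : 0 ≤ (inner ℂ (freqRestrict S f)
      ((K : ℂ) • freqRestrict S f - freqRestrict S g)).re := by
    apply re_inner_nonneg_of_ae
    filter_upwards [Lp.coeFn_sub ((K : ℂ) • freqRestrict S f) (freqRestrict S g),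
      Lp.coeFn_smul (K : ℂ) (freqRestrict S f), freqRestrict_ae_eq S f, freqRestrict_ae_eq S g,
      ae_restrict_of_ae h, ae_restrict_mem hS] with ξ h1 h2 h3 h4 h5 h6
    rw [h1, Pi.sub_apply, h2, Pi.smul_apply, h3, h4, h5]
    have e : inner ℂ ((𝓕 f : L2 n) ξ) ((K : ℂ) • (𝓕 f : L2 n) ξ - m ξ * (𝓕 f : L2 n) ξ) =
        (K - m ξ) * ((‖(𝓕 f : L2 n) ξ‖ ^ 2 : ℝ) : ℂ) := by
      rw [smul_eq_mul, ← sub_mul, ← smul_eq_mul, inner_smul_right, inner_self_eq_norm_sq_to_K]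
      simp
    rw [e, Complex.re_mul_ofReal, Complex.sub_re, Complex.ofReal_re]
    exact mul_nonneg (sub_nonneg.2 (hK ξ h6)) (sq_nonneg _)
  rw [inner_sub_right, inner_smul_right, inner_self_eq_norm_sq_to_K, Complex.sub_re] at key
  have e : ((K : ℂ) * ((‖freqRestrict S f‖ : ℂ)) ^ 2).re = K * ‖freqRestrict S f‖ ^ 2 := by
    rw [← Complex.ofReal_pow, Complex.re_ofReal_mul, Complex.ofReal_re]
  have key' : 0 ≤ K * ‖freqRestrict S f‖ ^ 2 -
      (inner ℂ (freqRestrict S f) (freqRestrict S g)).re := by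
    rw [← e]; exact key
  linarith

theorem le_re_inner_freqRestrict {n : ℕ} {S : Set (EuclideanSpace ℝ (Fin n))}
    (hS : MeasurableSet S) {m : EuclideanSpace ℝ (Fin n) → ℂ} {f g : L2 n}
    (h : ∀ᵐ ξ, (𝓕 g : L2 n) ξ = m ξ * (𝓕 f : L2 n) ξ) {K : ℝ} (hK : ∀ ξ ∈ S, K ≤ (m ξ).re) :
    K * ‖freqRestrict S f‖ ^ 2 ≤ (inner ℂ (freqRestrict S f) (freqRestrict S g)).re := by
  have h' : ∀ᵐ ξ, (𝓕 (-g) : L2 n) ξ = -m ξ * (𝓕 f : L2 n) ξ := by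
    have e : (𝓕 (-g) : L2 n) = -𝓕 g := map_neg (FourierTransform.fourierCLM ℂ (L2 n)) g
    rw [e]
    filter_upwards [Lp.coeFn_neg (𝓕 g : L2 n), h] with ξ h1 h2
    rw [h1, Pi.neg_apply, h2, neg_mul]
  have := re_inner_freqRestrict_le hS h' (K := -K) (fun ξ hξ => by simpa using hK ξ hξ)
  rw [map_neg, inner_neg_right, Complex.neg_re] at this
  linarith

/-! ### Energy estimates for low and high frequencies -/

section Energy

variable {n : ℕ} {T : ℝ} {u : ℝ → L2 n}

theorem MemH0.hasDerivAt (hu : MemH0 T u) {t : ℝ} (ht : t ∈ Ioo 0 T) :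
    HasDerivAt u (deriv u t) t :=
  ((hu.contDiffOn.mono Ioo_subset_Ico_self).differentiableOn one_ne_zero).differentiableAt
    (isOpen_Ioo.mem_nhds ht) |>.hasDerivAt

theorem MemH0.continuousOn_deriv (hu : MemH0 T u) : ContinuousOn (deriv u) (Ioo 0 T) :=
  (hu.contDiffOn.mono Ioo_subset_Ico_self).continuousOn_deriv_of_isOpen isOpen_Ioo le_rfl

theorem hasDerivAt_norm_sq_clm {H : Type*} [NormedAddCommGroup H] [InnerProductSpace ℂ H]
    (Φ : L2 n →L[ℂ] H) {u' : L2 n} {t : ℝ} (h : HasDerivAt u u' t) :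
    HasDerivAt (fun t => ‖Φ (u t)‖ ^ 2) (2 * (inner ℂ (Φ (u t)) (Φ u')).re) t := by
  have h1 : HasDerivAt (fun t => Φ (u t)) (Φ u') t :=
    (Φ.restrictScalars ℝ).hasFDerivAt.comp_hasDerivAt t h
  have h2 := Complex.reCLM.hasFDerivAt.comp_hasDerivAt t (h1.inner ℂ h1)
  convert! h2 using 1
  · ext t
    simp only [Function.comp_apply, Complex.reCLM_apply]
    exact (inner_self_eq_norm_sq (𝕜 := ℂ) (Φ (u t))).symm
  · rw [Complex.reCLM_apply, Complex.add_re, two_mul]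
    congr 1
    exact inner_re_symm (𝕜 := ℂ) _ _

theorem Coefficients.IsSolution.norm_sq_freqRestrict_le_exp {L : Coefficients n}
    (hsol : L.IsSolution T u) (hu : MemH0 T u) {S : Set (EuclideanSpace ℝ (Fin n))}
    (hS : MeasurableSet S) {K : ℝ} (hK : ∀ t ∈ Icc 0 T, ∀ ξ ∈ S, (L.symbol t ξ).re ≤ K)
    {s t : ℝ} (hs : 0 ≤ s) (hst : s ≤ t) (ht : t ≤ T) :
    ‖freqRestrict S (u t)‖ ^ 2 ≤ Real.exp (2 * K * (t - s)) * ‖freqRestrict S (u s)‖ ^ 2 := by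
  refine le_exp_mul_of_ae_deriv_le (T := T) (E := fun t => ‖freqRestrict S (u t)‖ ^ 2)
    (E' := fun t => 2 * (inner ℂ (freqRestrict S (u t)) (freqRestrict S (deriv u t))).re)
    ?_ (fun t ht => hasDerivAt_norm_sq_clm _ (hu.hasDerivAt ht)) ?_ ?_ hs hst ht
  · exact ((freqRestrict S).continuous.comp_continuousOn hu.continuousOn).norm.pow 2
  · have h1 := (freqRestrict S).continuous.comp_continuousOn
      (hu.continuousOn.mono Ioo_subset_Icc_self)
    have h2 := (freqRestrict S).continuous.comp_continuousOn hu.continuousOn_deriv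
    exact continuousOn_const.mul (Complex.continuous_re.comp_continuousOn (h1.inner (𝕜 := ℂ) h2))
  · filter_upwards [hsol, ae_restrict_mem measurableSet_Ioo] with t ht ht'
    have := re_inner_freqRestrict_le hS (L.fourier_ae_eq_symbol_mul t (u t) (deriv u t) ht)
      (hK t (Ioo_subset_Icc_self ht'))
    linarith

theorem Coefficients.IsSolution.exp_mul_norm_sq_freqRestrict_le {L : Coefficients n}
    (hsol : L.IsSolution T u) (hu : MemH0 T u) {S : Set (EuclideanSpace ℝ (Fin n))}
    (hS : MeasurableSet S) {K : ℝ} (hK : ∀ t ∈ Icc 0 T, ∀ ξ ∈ S, K ≤ (L.symbol t ξ).re)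
    {s t : ℝ} (hs : 0 ≤ s) (hst : s ≤ t) (ht : t ≤ T) :
    Real.exp (2 * K * (t - s)) * ‖freqRestrict S (u s)‖ ^ 2 ≤ ‖freqRestrict S (u t)‖ ^ 2 := by
  have := le_exp_mul_of_ae_deriv_le (T := T) (K := 2 * K)
    (E := fun t => -‖freqRestrict S (u t)‖ ^ 2)
    (E' := fun t => -(2 * (inner ℂ (freqRestrict S (u t)) (freqRestrict S (deriv u t))).re))
    ?_ (fun t ht => (hasDerivAt_norm_sq_clm _ (hu.hasDerivAt ht)).neg) ?_ ?_ hs hst ht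
  · linarith
  · exact (((freqRestrict S).continuous.comp_continuousOn hu.continuousOn).norm.pow 2).neg
  · have h1 := (freqRestrict S).continuous.comp_continuousOn
      (hu.continuousOn.mono Ioo_subset_Icc_self)
    have h2 := (freqRestrict S).continuous.comp_continuousOn hu.continuousOn_deriv
    exact (continuousOn_const.mul
      (Complex.continuous_re.comp_continuousOn (h1.inner (𝕜 := ℂ) h2))).neg
  · filter_upwards [hsol, ae_restrict_mem measurableSet_Ioo] with t ht ht'
    have := le_re_inner_freqRestrict hS (L.fourier_ae_eq_symbol_mul t (u t) (deriv u t) ht)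
      (hK t (Ioo_subset_Icc_self ht'))
    linarith

/-- Splitting the frequencies at a radius `R`: the low ones grow at most like `e^{2MR²t}` from
time `0`, and the high ones are dominated by their value at time `T`. -/
theorem Coefficients.IsSolution.norm_sq_le {L : Coefficients n} {kA kB kC D : ℝ}
    (hsol : L.IsSolution T u) (hu : MemH0 T u) (hL : L.Admissible T kA kB kC) (hkA : 0 < kA)
    (hkB : 0 < kB) (hkC : 0 < kC) (hD : ∀ t ∈ Icc 0 T, ‖u t‖ ≤ D) {R : ℝ} (hR : 1 ≤ R)
    (hR' : 2 * Real.pi * (n * kB) + kC ≤ 2 * Real.pi ^ 2 * kA * R) {t : ℝ} (ht : t ∈ Icc 0 T) :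
    ‖u t‖ ^ 2 ≤ Real.exp (2 * ((4 * Real.pi ^ 2 * kA⁻¹ + 2 * Real.pi * (n * kB) + kC) * R ^ 2) * t)
        * ‖u 0‖ ^ 2 +
      Real.exp (-(2 * (2 * Real.pi ^ 2 * kA * R ^ 2) * (T - t))) * D ^ 2 := by
  have hS : MeasurableSet (Metric.closedBall (0 : EuclideanSpace ℝ (Fin n)) R) :=
    measurableSet_closedBall
  have hT : (0 : ℝ) ≤ T := ht.1.trans ht.2
  rw [← norm_sq_freqRestrict_add hS (u t)]
  refine add_le_add ?_ ?_
  · have := hsol.norm_sq_freqRestrict_le_exp hu hS (fun t ht ξ hξ =>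
      hL.re_symbol_le hkA hkB hkC ht hR (mem_closedBall_zero_iff.1 hξ)) le_rfl ht.1 ht.2
    rw [sub_zero] at this
    exact this.trans (mul_le_mul_of_nonneg_left (norm_sq_freqRestrict_le hS _)
      (Real.exp_pos _).le)
  · have h1 := hsol.exp_mul_norm_sq_freqRestrict_le hu hS.compl (fun t ht ξ hξ =>
      hL.le_re_symbol hkA hkC ht hR hR'
        (not_le.1 (mt mem_closedBall_zero_iff.2 hξ)).le) ht.1 ht.2 le_rfl
    have h2 : ‖u T‖ ^ 2 ≤ D ^ 2 := by
      have := hD T ⟨hT, le_rfl⟩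
      gcongr
    have h3 := h1.trans ((norm_sq_freqRestrict_le hS.compl (u T)).trans h2)
    rw [Real.exp_neg, inv_mul_eq_div, le_div_iff₀ (Real.exp_pos _), mul_comm]
    exact h3

end Energy

/-! ### Hölder stability -/

open Filter Topology

/-- Hölder stability, in logarithmic form: the exponent `η` and the threshold `Λ₀` depend only on
the constants of the problem. -/
theorem exists_holder_stability (n : ℕ) (T T' kA kB kC : ℝ) (hT' : 0 < T') (hT'T : T' < T)
    (hkA : 0 < kA) (hkB : 0 < kB) (hkC : 0 < kC) :
    ∃ η Λ₀ : ℝ, 0 < η ∧ ∀ D : ℝ, ∀ L : Coefficients n, L.Admissible T kA kB kC →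
      ∀ u : ℝ → L2 n, MemH0 T u → L.IsSolution T u → (∀ t ∈ Icc 0 T, ‖u t‖ ≤ D) →
        ∀ Λ, Λ₀ ≤ Λ → ‖u 0‖ ^ 2 ≤ Real.exp (-Λ) →
          ∀ t ∈ Icc 0 T', ‖u t‖ ^ 2 ≤ (1 + D ^ 2) * Real.exp (-(η * Λ)) := by
  set M : ℝ := 4 * Real.pi ^ 2 * kA⁻¹ + 2 * Real.pi * (n * kB) + kC with hM
  set κ : ℝ := 2 * Real.pi ^ 2 * kA with hκ
  have hT : 0 < T := hT'.trans hT'T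
  have hMpos : 0 < M := by positivity
  have hκpos : 0 < κ := by positivity
  have hTT : 0 < T - T' := sub_pos.2 hT'T
  set R₀ : ℝ := max 1 ((2 * Real.pi * (n * kB) + kC) / κ) with hR₀
  have hR₀pos : 0 < R₀ := lt_of_lt_of_le one_pos (le_max_left _ _)
  refine ⟨min (1 / 2) (κ * (T - T') / (2 * M * T)), 4 * M * T * R₀ ^ 2, by positivity, ?_⟩
  intro D L hL u hu hsol hD Λ hΛ h0 t ht
  have hΛpos : 0 < Λ := lt_of_lt_of_le (by positivity) hΛ
  -- This radius makes the growth factor of the low frequencies at most `e^{Λ/2}`.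
  set R : ℝ := √(Λ / (4 * M * T)) with hR
  have hR2 : R ^ 2 = Λ / (4 * M * T) := Real.sq_sqrt (by positivity)
  have hRR : R₀ ≤ R := Real.le_sqrt_of_sq_le (by
    rw [le_div_iff₀ (by positivity)]
    linarith)
  have hR1 : 1 ≤ R := (le_max_left _ _).trans hRR
  have hRκ : 2 * Real.pi * (n * kB) + kC ≤ κ * R := by
    rw [mul_comm κ, ← div_le_iff₀ hκpos]
    exact (le_max_right _ _).trans hRR
  have htT : t ∈ Icc 0 T := ⟨ht.1, ht.2.trans hT'T.le⟩
  have key := hsol.norm_sq_le hu hL hkA hkB hkC hD hR1 hRκ htT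
  rw [← hM, ← hκ, hR2] at key
  set η : ℝ := min (1 / 2) (κ * (T - T') / (2 * M * T)) with hη
  have h1 : Real.exp (2 * (M * (Λ / (4 * M * T))) * t) * ‖u 0‖ ^ 2 ≤ Real.exp (-(η * Λ)) := by
    refine (mul_le_mul_of_nonneg_left h0 (Real.exp_pos _).le).trans ?_
    rw [← Real.exp_add, Real.exp_le_exp]
    have e1 : 2 * (M * (Λ / (4 * M * T))) * t ≤ Λ / 2 :=
      calc 2 * (M * (Λ / (4 * M * T))) * t ≤ 2 * (M * (Λ / (4 * M * T))) * T := by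
            gcongr
            exact htT.2
        _ = Λ / 2 := by field_simp; norm_num
    have e2 : η * Λ ≤ 1 / 2 * Λ := by gcongr; exact min_le_left _ _
    linarith
  have h2 : Real.exp (-(2 * (κ * (Λ / (4 * M * T))) * (T - t))) ≤ Real.exp (-(η * Λ)) := by
    rw [Real.exp_le_exp, neg_le_neg_iff]
    calc η * Λ ≤ κ * (T - T') / (2 * M * T) * Λ := by gcongr; exact min_le_right _ _
      _ = 2 * (κ * (Λ / (4 * M * T))) * (T - T') := by field_simp; norm_num
      _ ≤ 2 * (κ * (Λ / (4 * M * T))) * (T - t) := by gcongr; exact ht.2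
  have h3 := mul_le_mul_of_nonneg_right h2 (sq_nonneg D)
  linarith

/-! ### The modulus of stability -/

/-- `exp √(log (Λ/2))` is negligible against `Λ`. -/
theorem eventually_exp_rpow_log_add_le {η : ℝ} (hη : 0 < η) (C : ℝ) :
    ∀ᶠ Λ in atTop, Real.exp (Real.log (1 / 2 * Λ) ^ (1 / 2 : ℝ)) + C ≤ η * Λ := by
  have hw : Tendsto (fun Λ : ℝ => Real.log (1 / 2 * Λ)) atTop atTop :=
    Real.tendsto_log_atTop.comp (tendsto_id.const_mul_atTop (by norm_num))
  filter_upwards [hw.eventually_ge_atTop 4, hw.eventually_ge_atTop (-(2 * Real.log η)),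
    eventually_gt_atTop 0, (tendsto_id.const_mul_atTop hη).eventually_ge_atTop (2 * C)]
    with Λ h4 hη' h0 hC
  simp only [id] at hC
  set w := Real.log (1 / 2 * Λ) with hwdef
  have hsq : √w ≤ w / 2 := Real.sqrt_le_iff.2 ⟨by linarith, by nlinarith⟩
  have h1 : Real.exp (w ^ (1 / 2 : ℝ)) ≤ η * (1 / 2 * Λ) := by
    rw [← Real.sqrt_eq_rpow, ← Real.exp_log hη, ← Real.exp_log (by positivity : 0 < 1 / 2 * Λ),
      ← Real.exp_add, Real.exp_le_exp]
    linarith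
  linarith

/-- For `σ = τ = 1`, `δ = 1/2`, in the variable `Λ = -log y`. -/
theorem doubleExpBound_eq {y : ℝ} (hy : 0 ≤ -Real.log y) : doubleExpBound 1 1 (1 / 2) y =
    Real.exp (-Real.exp (Real.log (1 / 2 * -Real.log y) ^ (1 / 2 : ℝ))) := by
  rw [doubleExpBound, ← abs_neg, abs_of_nonneg hy]
  norm_num

theorem two_le_neg_log {r y : ℝ} (hr : r ≤ Real.exp (-2)) (hy : y ∈ Ioc 0 r) :
    2 ≤ -Real.log y := by
  have := Real.log_le_log hy.1 (hy.2.trans hr)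
  rw [Real.log_exp] at this
  linarith

theorem strictMonoOn_doubleExpBound {r : ℝ} (hr : r ≤ Real.exp (-2)) :
    StrictMonoOn (doubleExpBound 1 1 (1 / 2)) (Ioc 0 r) := by
  intro x hx y hy hxy
  have hx2 := two_le_neg_log hr hx
  have hy2 := two_le_neg_log hr hy
  rw [doubleExpBound_eq (by linarith), doubleExpBound_eq (by linarith), Real.exp_lt_exp,
    neg_lt_neg_iff, Real.exp_lt_exp]
  have hlog := Real.log_lt_log hx.1 hxy
  refine Real.rpow_lt_rpow (Real.log_nonneg (by linarith)) ?_ (by norm_num)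
  exact Real.log_lt_log (by linarith) (by linarith)

theorem continuousOn_doubleExpBound {r : ℝ} (hr : r ≤ Real.exp (-2)) :
    ContinuousOn (doubleExpBound 1 1 (1 / 2)) (Ioc 0 r) := by
  have hc : ContinuousOn (fun y : ℝ =>
      Real.exp (-Real.exp (Real.log (1 / 2 * -Real.log y) ^ (1 / 2 : ℝ)))) (Ioc 0 r) := by
    have h1 : ContinuousOn (fun y : ℝ => 1 / 2 * -Real.log y) (Ioc 0 r) :=
      continuousOn_const.mul (Real.continuousOn_log.mono fun y hy => hy.1.ne').neg
    have h2 : ContinuousOn (fun y : ℝ => Real.log (1 / 2 * -Real.log y)) (Ioc 0 r) :=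
      h1.log fun y hy => by have := two_le_neg_log hr hy; linarith
    exact (h2.rpow_const fun y _ => Or.inr (by norm_num)).rexp.neg.rexp
  exact hc.congr fun y hy => doubleExpBound_eq (by have := two_le_neg_log hr hy; linarith)

theorem tendsto_doubleExpBound_zero :
    Tendsto (doubleExpBound 1 1 (1 / 2)) (𝓝[>] 0) (𝓝 0) := by
  have h1 : Tendsto (fun y : ℝ => -Real.log y) (𝓝[>] 0) atTop :=
    tendsto_neg_atBot_atTop.comp Real.tendsto_log_nhdsGT_zero
  have h2 : Tendsto (fun y : ℝ =>
      Real.exp (-Real.exp (Real.log (1 / 2 * -Real.log y) ^ (1 / 2 : ℝ)))) (𝓝[>] 0) (𝓝 0) :=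
    Real.tendsto_exp_neg_atTop_nhds_zero.comp <| Real.tendsto_exp_atTop.comp <|
      (tendsto_rpow_atTop (by norm_num)).comp <| Real.tendsto_log_atTop.comp <|
      h1.const_mul_atTop (by norm_num)
  refine h2.congr' ?_
  filter_upwards [h1.eventually_ge_atTop 0] with y hy using (doubleExpBound_eq hy).symm

/-- A function on `[0, r]` extends to `[0, ∞)` with slope one, continuity and strict monotonicity
being preserved. -/
theorem exists_strictMonoOn_extension {r : ℝ} (hr : 0 < r) {B : ℝ → ℝ}
    (hc : ContinuousOn B (Icc 0 r)) (hm : StrictMonoOn B (Icc 0 r)) :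
    ∃ G : ℝ → ℝ, ContinuousOn G (Ici 0) ∧ StrictMonoOn G (Ici 0) ∧ EqOn G B (Icc 0 r) := by
  have hmem : ∀ x ∈ Ici (0 : ℝ), min x r ∈ Icc 0 r := fun x hx =>
    ⟨le_min hx hr.le, min_le_right _ _⟩
  refine ⟨fun x => B (min x r) + max (x - r) 0, ?_, ?_, ?_⟩
  · exact (hc.comp (by fun_prop) hmem).add (by fun_prop)
  · intro x hx y hy hxy
    rcases lt_or_ge x r with h | h
    · refine add_lt_add_of_lt_of_le (hm (hmem x hx) (hmem y hy) ?_) ?_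
      · rw [min_eq_left h.le]
        exact lt_min hxy h
      · gcongr
    · simp only [min_eq_right h, min_eq_right (h.trans hxy.le)]
      rw [max_eq_left (sub_nonneg.2 h), max_eq_left (sub_nonneg.2 (h.trans hxy.le))]
      linarith
  · intro x hx
    simp only [min_eq_left hx.2, max_eq_right (sub_nonpos.2 hx.2), add_zero]

theorem exists_modulus {r : ℝ} (hr0 : 0 < r) (hr : r ≤ Real.exp (-2)) :
    ∃ G : ℝ → ℝ, ContinuousOn G (Ici 0) ∧ StrictMonoOn G (Ici 0) ∧ G 0 = 0 ∧
      ∀ y ∈ Ioc 0 r, G y = doubleExpBound 1 1 (1 / 2) y := by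
  -- The junk value of `doubleExpBound` at `0` is replaced by the limit there.
  set B := Function.update (doubleExpBound 1 1 (1 / 2)) 0 0 with hB
  have hB0 : B 0 = 0 := Function.update_self _ _ _
  have hBy : ∀ y, 0 < y → B y = doubleExpBound 1 1 (1 / 2) y := fun y hy =>
    Function.update_of_ne hy.ne' _ _
  have hc : ContinuousOn B (Icc 0 r) := by
    rw [hB, continuousOn_update_iff, Icc_sdiff_left]
    exact ⟨continuousOn_doubleExpBound hr, fun _ => tendsto_doubleExpBound_zero.mono_left
      (nhdsWithin_mono _ Ioc_subset_Ioi_self)⟩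
  have hm : StrictMonoOn B (Icc 0 r) := by
    intro x hx y hy hxy
    have hy0 : 0 < y := hx.1.trans_lt hxy
    rw [hBy y hy0]
    rcases hx.1.eq_or_lt with h | h
    · rw [← h, hB0]
      exact Real.exp_pos _
    · rw [hBy x h]
      exact strictMonoOn_doubleExpBound hr ⟨h, hx.2⟩ ⟨hy0, hy.2⟩ hxy
  obtain ⟨G, h1, h2, h3⟩ := exists_strictMonoOn_extension hr0 hc hm
  exact ⟨G, h1, h2, (h3 ⟨le_rfl, hr0.le⟩).trans hB0, fun y hy =>
    (h3 (Ioc_subset_Icc_self hy)).trans (hBy y hy.1)⟩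

end BackwardParabolic

theorem mainTheorem5 (n : ℕ) (T T' kA kB kC : ℝ) (hT' : 0 < T') (hT'T : T' < T)
    (hkA : 0 < kA) (hkB : 0 < kB) (hkC : 0 < kC) :
    ∃ σ τ δ : ℝ, 0 < σ ∧ 0 < τ ∧ 0 < δ ∧ δ < 1 ∧
      ∀ D : ℝ, 0 < D → ∃ ρ : ℝ, 0 < ρ ∧ ρ ^ 2 ≤ Real.exp (-(2 * τ)) ∧
        ∃ G : ℝ → ℝ, ContinuousOn G (Ici 0) ∧ StrictMonoOn G (Ici 0) ∧ G 0 = 0 ∧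
          (∀ y ∈ Ioc 0 (ρ ^ 2), G y = BackwardParabolic.doubleExpBound σ τ δ y) ∧
          ∀ L : BackwardParabolic.Coefficients n, L.Admissible T kA kB kC →
            ∀ u : ℝ → BackwardParabolic.L2 n, BackwardParabolic.MemH0 T u → L.IsSolution T u →
              (∀ t ∈ Icc 0 T, ‖u t‖ ≤ D) → ‖u 0‖ ≤ ρ →
                ∀ t ∈ Icc 0 T', ‖u t‖ ^ 2 ≤ G (‖u 0‖ ^ 2) := by
  obtain ⟨η, Λ₀, hη, hstab⟩ :=
    BackwardParabolic.exists_holder_stability n T T' kA kB kC hT' hT'T hkA hkB hkC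
  refine ⟨1, 1, 1 / 2, one_pos, one_pos, by norm_num, by norm_num, fun D _ => ?_⟩
  obtain ⟨Λ₁, hΛ₁⟩ := Filter.eventually_atTop.1
    (BackwardParabolic.eventually_exp_rpow_log_add_le hη (Real.log (1 + D ^ 2)))
  set Λ₂ : ℝ := max 2 (max Λ₀ Λ₁) with hΛ₂
  have h2 : 2 ≤ Λ₂ := le_max_left _ _
  have hΛ₀ : Λ₀ ≤ Λ₂ := (le_max_left _ _).trans (le_max_right _ _)
  have hΛ₁₂ : Λ₁ ≤ Λ₂ := (le_max_right _ _).trans (le_max_right _ _)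
  have hsq : Real.exp (-(Λ₂ / 2)) ^ 2 = Real.exp (-Λ₂) := by
    rw [← Real.exp_nat_mul]
    congr 1
    push_cast
    ring
  have hr : Real.exp (-Λ₂) ≤ Real.exp (-2) := Real.exp_le_exp.2 (by linarith)
  obtain ⟨G, hGc, hGm, hG0, hG⟩ := BackwardParabolic.exists_modulus (Real.exp_pos _) hr
  refine ⟨Real.exp (-(Λ₂ / 2)), Real.exp_pos _, by rw [hsq]; simpa using hr, G, hGc, hGm, hG0,
    by rwa [hsq], ?_⟩
  intro L hL u hu hsol hD h0 t ht
  have h0' : ‖u 0‖ ^ 2 ≤ Real.exp (-Λ₂) := by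
    rw [← hsq]
    gcongr
  have hbound := hstab D L hL u hu hsol hD
  rcases (sq_nonneg ‖u 0‖).eq_or_lt with hz | hpos
  · -- The Hölder bound holds for all large `Λ`, so it can be sent to its limit.
    rw [← hz, hG0]
    have hlim : Filter.Tendsto (fun Λ : ℝ => (1 + D ^ 2) * Real.exp (-(η * Λ)))
        Filter.atTop (nhds 0) := by
      simpa using (Real.tendsto_exp_neg_atTop_nhds_zero.comp
        (Filter.tendsto_id.const_mul_atTop hη)).const_mul (1 + D ^ 2)
    refine ge_of_tendsto hlim ?_
    filter_upwards [Filter.eventually_ge_atTop Λ₀] with Λ hΛ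
    exact hbound Λ hΛ (hz ▸ (Real.exp_pos _).le) t ht
  · have hlog : Λ₂ ≤ -Real.log (‖u 0‖ ^ 2) := by
      have := Real.log_le_log hpos h0'
      rw [Real.log_exp] at this
      linarith
    refine (hbound _ (hΛ₀.trans hlog) (by rw [neg_neg, Real.exp_log hpos]) t ht).trans ?_
    rw [hG _ ⟨hpos, h0'⟩, BackwardParabolic.doubleExpBound_eq (by linarith)]
    calc (1 + D ^ 2) * Real.exp (-(η * -Real.log (‖u 0‖ ^ 2)))
        = Real.exp (Real.log (1 + D ^ 2) - η * -Real.log (‖u 0‖ ^ 2)) := by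
          rw [sub_eq_add_neg, Real.exp_add, Real.exp_log (by positivity)]
      _ ≤ _ := by
          rw [Real.exp_le_exp]
          have := hΛ₁ _ (hΛ₁₂.trans hlog)
          linarith
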